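/- \textbf{Setting.} Let $(X,\mu)$ be a standard Borel probability space and $T:X\to X$ an ergodic invertible measure-preserving transformation. Let $\pi:(X,\mu,T)\to(Z,\alpha)$ be the projection onto the Kronecker factor: $Z$ is a compact metrizable abelian group with its Haar probability measure, $\alpha\in Z$ generates a dense subgroup, $\pi$ is measurable, pushes $\mu$ to the Haar measure and satisfies $\pi(Tx)=\pi(x)+\alpha$ for almost every $x$, and every $L^2$-eigenfunction of $T$ agrees almost everywhere with a measurable function of $\pi(x)$. Let $\mu=\int_Z\mu_z\,dz$ be the disintegration of $\mu$ over $\pi$. Let $a_1,a_2$ be distinct non-zero integers and put \[ Z'=\overline{\{(a_1n\alpha,a_2n\alpha):n\in\mathbb Z\}}\subset Z^2,\qquad \tilde Z=\{(z,z_1,z_2)\in Z^3:(z_1-z,z_2-z)\in Z'\}, \] \[ \tilde X=\{(x,\xi_1,\xi_2)\in X^3:(\pi x,\pi\xi_1,\pi\xi_2)\in\tilde Z\},\qquad \tilde\mu=\int_{\tilde Z}\mu_{z_0}\otimes\mu_{z_1}\otimes\mu_{z_2}\,d(z_0,z_1,z_2), \] the last integral being with respect to the Haar probability measure on the compact group $\tilde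 Z$. Let $\tilde T=(T,T,T)$, acting on $X^3$; the measure $\tilde\mu$ is concentrated on $\tilde X$. For an invertible measure-preserving transformation $S$ of a probability space $(Y,\nu)$, a non-zero integer $c$ and a bounded measurable real- or complex-valued function $f$ put \[ \|f\|_{U^1(Y,\nu,S,c)}=\|\mathbb E(f\mid I_{S^c})\|_{L^2(\nu)},\qquad \|f\|_{U^{l+1}(Y,\nu,S,c)}^{2^{l+1}}=\limsup_{H\to\infty}\frac1{2H+1}\sum_{h=-H}^{H}\big\|\overline f\cdot (f\circ S^h)\big\|_{U^l(Y,\nu,S,c)}^{2^l}\quad(l\ge1), \] where $I_{S^c}$ is the $\sigma$-algebra of $S^c$-invariant sets (the conjugation is absent for real-valued $f$), and write $\|f\|_{U^l(Y,\nu,S)}=\|f\|_{U^l(Y,\nu,S,1)}$. \textbf{Lemma.} Let $i\in\{1,2\}$, let $f_i\in L^\infty(X,\mu)$ be real- or complex-valued, and define $F_i(x,\xi_1,\xi_2)=f_i(x)f_i(\xi_i)$ on $\tilde X$. Then for all integers $l\ge1$ and $c\ge1$ \[ \|F_i\|_{U^l(\tilde X,\tilde\mu,\tilde T,c)}\le C\,\|f_i\|_{U^{l+1}(X,\mu,T)}^2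 , \] where the constant $C$ depends only on $a_i$, $l$ and $c$. -/

import Mathlib

open MeasureTheory ProbabilityTheory Filter Topology
open scoped ENNReal ComplexConjugate

namespace ErgodicLift

set_option linter.unusedSectionVars false

noncomputable section

/-- The `n`-th power of an invertible transformation `T`, for an integer `n`. -/
def iter {X : Type*} [MeasurableSpace X] (T : X ≃ᵐ X) (n : ℤ) : X → X :=
  ((T.toEquiv : Equiv.Perm X) ^ n : Equiv.Perm X)

/-- The uniformity seminorms `‖f‖_{U^l(X,μ,T,c)}`, for `l ≥ 1`:
`‖f‖_{U^1} = ‖E(f | I_{T^c})‖_{L²}`, where `I_{T^c}` is the `σ`-algebra of `T^c`-invariant sets, and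
`‖f‖_{U^{l+1}}^{2^{l+1}} = limsup_H (2H+1)⁻¹ ∑_{|h| ≤ H} ‖conj f · f ∘ T^h‖_{U^l}^{2^l}`.
The conjugation is the identity for real-valued functions.
The value at `l = 0` is a placeholder without meaning. -/
def uniformitySeminorm {X 𝕜 : Type*} [MeasurableSpace X] [RCLike 𝕜]
    (μ : Measure X) (T : X ≃ᵐ X) (c : ℤ) : ℕ → (X → 𝕜) → ℝ
  | 0, _ => 0
  | 1, f => (eLpNorm (μ[f | MeasurableSpace.invariants (iter T c)]) 2 μ).toReal
  | l + 2, f =>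
      (limsup (fun H : ℕ => (2 * (H : ℝ) + 1)⁻¹ * ∑ h ∈ Finset.Icc (-(H : ℤ)) (H : ℤ),
        uniformitySeminorm μ T c (l + 1) (fun x => conj (f x) * f (iter T h x)) ^ (2 ^ (l + 1)))
        atTop) ^ ((1 : ℝ) / 2 ^ (l + 2))

/-- The Haar measure of a compact group, normalised to be a probability measure. -/
def haarProb (G : Type*) [AddCommGroup G] [TopologicalSpace G] [IsTopologicalAddGroup G]
    [CompactSpace G] [MeasurableSpace G] [BorelSpace G] : Measure G :=
  Measure.addHaarMeasure (⊤ : TopologicalSpace.PositiveCompacts G)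

instance haarProb.isProbabilityMeasure (G : Type*) [AddCommGroup G] [TopologicalSpace G]
    [IsTopologicalAddGroup G] [CompactSpace G] [MeasurableSpace G] [BorelSpace G] :
    IsProbabilityMeasure (haarProb G) := by
  refine ⟨?_⟩
  have h := Measure.addHaarMeasure_self (K₀ := (⊤ : TopologicalSpace.PositiveCompacts G))
  simpa [haarProb] using h

instance haarProb.isAddHaarMeasure (G : Type*) [AddCommGroup G] [TopologicalSpace G]
    [IsTopologicalAddGroup G] [CompactSpace G] [MeasurableSpace G] [BorelSpace G] :
    (haarProb G).IsAddHaarMeasure := by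
  unfold haarProb; infer_instance

section Kronecker

variable {X Z : Type*} [MeasurableSpace X] [AddCommGroup Z] [TopologicalSpace Z]
  [IsTopologicalAddGroup Z] [CompactSpace Z] [MeasurableSpace Z] [BorelSpace Z]

/-- `π : (X, μ, T) → (Z, α)` is the projection onto the Kronecker factor: `Z` is a compact abelian
group in which `α` generates a dense subgroup, `π` is a factor map onto the rotation by `α` on `Z`
with its Haar measure, and `π` is maximal among these, in the sense that every
`L²`-eigenfunction of `T` is almost everywhere equal to a function of `π x`. -/
structure IsKroneckerFactor (μ : Measure X) (T : X ≃ᵐ X) (π : X → Z) (α : Z) : Prop where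
  dense_zmultiples : Dense (AddSubgroup.zmultiples α : Set Z)
  measurePreserving : MeasurePreserving π μ (haarProb Z)
  equivariant : ∀ᵐ x ∂μ, π (T x) = π x + α
  eigenfunction : ∀ (f : X → ℂ) (θ : ℂ), MemLp f 2 μ → (∀ᵐ x ∂μ, f (T x) = θ * f x) →
    ∃ g : Z → ℂ, Measurable g ∧ f =ᵐ[μ] g ∘ π

/-- The closed subgroup `Z'` of `Z × Z` generated by `(a₁ α, a₂ α)`. -/
def orbitClosure (α : Z) (a : Fin 2 → ℤ) : AddSubgroup (Z × Z) :=
  (AddSubgroup.zmultiples (a 0 • α, a 1 • α)).topologicalClosure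

/-- The group `Z̃ = {(z, z₁, z₂) : (z₁ - z, z₂ - z) ∈ Z'}`. -/
def kroneckerJoining (α : Z) (a : Fin 2 → ℤ) : AddSubgroup (Z × Z × Z) where
  carrier := {p | (p.2.1 - p.1, p.2.2 - p.1) ∈ orbitClosure α a}
  zero_mem' := by
    change ((0 : Z) - 0, (0 : Z) - 0) ∈ orbitClosure α a
    rw [sub_zero]
    exact (orbitClosure α a).zero_mem
  add_mem' := by
    intro p q hp hq
    have h := (orbitClosure α a).add_mem hp hq
    simpa [add_sub_add_comm] using h
  neg_mem' := by
    intro p hp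
    have h := (orbitClosure α a).neg_mem hp
    simpa [sub_eq_add_neg, add_comm] using h

theorem isClosed_kroneckerJoining (α : Z) (a : Fin 2 → ℤ) :
    IsClosed (kroneckerJoining α a : Set (Z × Z × Z)) := by
  have h : IsClosed (orbitClosure α a : Set (Z × Z)) :=
    AddSubgroup.isClosed_topologicalClosure _
  exact h.preimage (f := fun p : Z × Z × Z => (p.2.1 - p.1, p.2.2 - p.1)) (by fun_prop)

instance (α : Z) (a : Fin 2 → ℤ) : CompactSpace (kroneckerJoining α a) :=
  isCompact_iff_compactSpace.mp (isClosed_kroneckerJoining α a).isCompact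

/-- The set `X̃ = {(x, ξ₁, ξ₂) : (π x, π ξ₁, π ξ₂) ∈ Z̃}`. -/
def joiningSet (π : X → Z) (α : Z) (a : Fin 2 → ℤ) : Set (X × X × X) :=
  {p | (π p.1, π p.2.1, π p.2.2) ∈ kroneckerJoining α a}

/-- The disintegration `z ↦ μ_z` of `μ` over the map `π`. -/
def disintegration [StandardBorelSpace X] [Nonempty X] (μ : Measure X) [IsFiniteMeasure μ]
    (π : X → Z) : Kernel Z X :=
  condDistrib id π μ

instance [StandardBorelSpace X] [Nonempty X] (μ : Measure X) [IsFiniteMeasure μ] (π : X → Z) :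
    IsMarkovKernel (disintegration μ π) := by
  unfold disintegration; infer_instance

/-- The measure `μ̃ = ∫ μ_{z₀} ⊗ μ_{z₁} ⊗ μ_{z₂} d(z₀, z₁, z₂)`, the integral being over `Z̃` with
its Haar measure. It is a measure on `X × X × X` which is concentrated on `X̃`, see
`joiningMeasure_compl_joiningSet`. -/
def joiningMeasure [SecondCountableTopology Z] [StandardBorelSpace X] [Nonempty X]
    (μ : Measure X) [IsFiniteMeasure μ] (π : X → Z) (α : Z) (a : Fin 2 → ℤ) :
    Measure (X × X × X) :=
  (haarProb (kroneckerJoining α a)).bind fun z =>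
    (disintegration μ π z.1.1).prod
      ((disintegration μ π z.1.2.1).prod (disintegration μ π z.1.2.2))

theorem map_haarProb {G H : Type*} [AddCommGroup G] [TopologicalSpace G] [IsTopologicalAddGroup G]
    [CompactSpace G] [MeasurableSpace G] [BorelSpace G] [AddCommGroup H] [TopologicalSpace H]
    [IsTopologicalAddGroup H] [CompactSpace H] [T2Space H] [MeasurableSpace H] [BorelSpace H]
    (φ : G →+ H) (hφ : Continuous φ) (hs : Function.Surjective φ) :
    (haarProb G).map φ = haarProb H := by
  have h1 : ((haarProb G).map φ).IsAddHaarMeasure :=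
    Measure.isAddHaarMeasure_map _ φ hφ hs (by simp [Filter.cocompact_eq_bot])
  have h2 : IsProbabilityMeasure ((haarProb G).map φ) :=
    Measure.isProbabilityMeasure_map hφ.measurable.aemeasurable
  exact Measure.isAddHaarMeasure_eq_of_isProbabilityMeasure _ _

section Joining

variable [T2Space Z] [SecondCountableTopology Z] [StandardBorelSpace X] [Nonempty X]
  (μ : Measure X) [IsProbabilityMeasure μ]

theorem measurable_joiningKernel (π : X → Z) (α : Z) (a : Fin 2 → ℤ) :
    Measurable fun z : kroneckerJoining α a =>
      (disintegration μ π z.1.1).prod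
        ((disintegration μ π z.1.2.1).prod (disintegration μ π z.1.2.2)) := by
  let κ : Kernel (kroneckerJoining α a) (X × X × X) :=
    ((disintegration μ π).comap (fun z => z.1.1) (by fun_prop)) ×ₖ
      (((disintegration μ π).comap (fun z => z.1.2.1) (by fun_prop)) ×ₖ
        ((disintegration μ π).comap (fun z => z.1.2.2) (by fun_prop)))
  convert κ.measurable using 1
  ext1 z
  simp [κ, Kernel.prod_apply, Kernel.comap_apply]

instance (π : X → Z) (α : Z) (a : Fin 2 → ℤ) : IsProbabilityMeasure (joiningMeasure μ π α a) := by
  refine ⟨?_⟩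
  rw [joiningMeasure, Measure.bind_apply MeasurableSet.univ
    (measurable_joiningKernel μ π α a).aemeasurable]
  simp

variable {μ}

/-- Almost every `μ_z` is concentrated on the fibre of `π` over `z`. -/
theorem disintegration_fibre {π : X → Z} (hπ : MeasurePreserving π μ (haarProb Z)) :
    ∀ᵐ z ∂(haarProb Z), ∀ᵐ x ∂(disintegration μ π z), π x = z := by
  have hm := hπ.measurable
  have h := compProd_map_condDistrib (mβ := inferInstance) (μ := μ) (X := π) (Y := (id : X → X)) aemeasurable_id
  rw [hπ.map_eq] at h
  have hs : MeasurableSet {p : Z × X | π p.2 = p.1} :=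
    measurableSet_eq_fun (by fun_prop) (by fun_prop)
  refine Measure.ae_ae_of_ae_compProd (p := fun p : Z × X => π p.2 = p.1) ?_
  rw [disintegration, h, ae_map_iff (by fun_prop) hs]
  simp

/-- The measure `μ̃` is concentrated on `X̃`. -/
theorem joiningMeasure_compl_joiningSet {π : X → Z} (hπ : MeasurePreserving π μ (haarProb Z))
    (α : Z) (a : Fin 2 → ℤ) : joiningMeasure μ π α a (joiningSet π α a)ᶜ = 0 := by
  have hm := hπ.measurable
  have hs : MeasurableSet (joiningSet π α a) :=
    (isClosed_kroneckerJoining α a).measurableSet.preimage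
      (f := fun p : X × X × X => (π p.1, π p.2.1, π p.2.2)) (by fun_prop)
  have hdiag : ∀ z : Z, (z, z, z) ∈ kroneckerJoining α a := by
    intro z
    change (z - z, z - z) ∈ orbitClosure α a
    rw [sub_self]
    exact (orbitClosure α a).zero_mem
  have key : ∀ φ : kroneckerJoining α a →+ Z, Continuous φ →
      (∀ z, φ ⟨(z, z, z), hdiag z⟩ = z) →
      ∀ᵐ w ∂(haarProb (kroneckerJoining α a)), ∀ᵐ x ∂(disintegration μ π (φ w)), π x = φ w := by
    intro φ hφ hd
    have h := disintegration_fibre hπ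
    rw [← map_haarProb φ hφ (fun z => ⟨_, hd z⟩)] at h
    exact ae_of_ae_map hφ.measurable.aemeasurable h
  have h0 := key ((AddMonoidHom.fst Z (Z × Z)).comp (kroneckerJoining α a).subtype)
    (by simpa using continuous_fst.comp continuous_subtype_val) (fun _ => rfl)
  have h1 := key (((AddMonoidHom.fst Z Z).comp (AddMonoidHom.snd Z (Z × Z))).comp
    (kroneckerJoining α a).subtype)
    (continuous_fst.comp (continuous_snd.comp continuous_subtype_val)) (fun _ => rfl)
  have h2 := key (((AddMonoidHom.snd Z Z).comp (AddMonoidHom.snd Z (Z × Z))).comp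
    (kroneckerJoining α a).subtype)
    (continuous_snd.comp (continuous_snd.comp continuous_subtype_val)) (fun _ => rfl)
  rw [joiningMeasure, Measure.bind_apply hs.compl
    (measurable_joiningKernel μ π α a).aemeasurable]
  refine (lintegral_eq_zero_iff' ?_).2 ?_
  · exact ((Measure.measurable_coe hs.compl).comp
      (measurable_joiningKernel μ π α a)).aemeasurable
  filter_upwards [h0, h1, h2] with w w0 w1 w2
  change _ = (0 : ℝ≥0∞)
  rw [← mem_ae_iff]
  have e0 := Measure.quasiMeasurePreserving_fst.ae (μa := (disintegration μ π w.1.1).prod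
      ((disintegration μ π w.1.2.1).prod (disintegration μ π w.1.2.2))) w0
  have e12 := Measure.quasiMeasurePreserving_fst.ae (μa := (disintegration μ π w.1.2.1).prod
      (disintegration μ π w.1.2.2)) w1
  have e22 := Measure.quasiMeasurePreserving_snd.ae (μa := (disintegration μ π w.1.2.1).prod
      (disintegration μ π w.1.2.2)) w2
  have e1 := Measure.quasiMeasurePreserving_snd.ae (μa := (disintegration μ π w.1.1).prod
      ((disintegration μ π w.1.2.1).prod (disintegration μ π w.1.2.2))) e12
  have e2 := Measure.quasiMeasurePreserving_snd.ae (μa := (disintegration μ π w.1.1).prod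
      ((disintegration μ π w.1.2.1).prod (disintegration μ π w.1.2.2))) e22
  filter_upwards [e0, e1, e2] with p p0 p1 p2
  change (π p.1, π p.2.1, π p.2.2) ∈ kroneckerJoining α a
  simp only [AddMonoidHom.comp_apply, AddSubgroup.subtype_apply, AddMonoidHom.coe_fst,
    AddMonoidHom.coe_snd] at p0 p1 p2
  rw [p0, p1, p2]
  exact w.2

end Joining

end Kronecker

/-- The transformation `T̃ = (T, T, T)`. -/
def joiningMap {X : Type*} [MeasurableSpace X] (T : X ≃ᵐ X) : X × X × X ≃ᵐ X × X × X :=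
  T.prodCongr (T.prodCongr T)

/-- The function `F_i(x, ξ₁, ξ₂) = f(x) f(ξ_i)`; the index `i = 1, 2` is `0, 1 : Fin 2`. -/
def lift {X 𝕜 : Type*} [Mul 𝕜] (i : Fin 2) (f : X → 𝕜) (p : X × X × X) : 𝕜 :=
  f p.1 * f (![p.2.1, p.2.2] i)

end

end ErgodicLift

/-! The triples enter only through the pair `(x, ξ_i)`, and the law of that pair under `μ̃` is at
most `|a_i|` times `μ ⊗ μ`. Indeed `(z, z_i)` maps `Z̃` onto a closed subgroup of `Z × Z` that
contains every `(z, z + q a_i α)`. Since `α` generates a dense subgroup, at most `|a_i|` translates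
of this subgroup cover `Z × Z`. So its normalised Haar measure is at most `|a_i|` times that of `Z ×
Z`, and integrating `μ_z ⊗ μ_w` preserves the inequality (`map_pairProj_joiningMeasure_le`).

For `l = 1`, the conditional expectation of `F_i` on the `T̃^c`-invariant sets is bounded in `L²` by
any ergodic mean of `F_i` along `T̃^c`. Domination moves this mean to `μ ⊗ μ`. There the square
expands by Fubini into squares of correlations of `f` at times `c (n - m)`, each at most the `U¹`
seminorm of a multiplicative derivative of `f`. Averaging over `m, n` gives `‖F_i‖_{U¹}² ≤ 3 c |a_i|
‖f‖_{U²}⁴`.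

The derivative of `F_i` along `T̃` is the lift of the derivative of `f` (`mulDeriv_lift`), so
induction on `l` carries the same factor `3 c |a_i|` through the recursive definition of both
seminorms. -/

namespace ErgodicLift

set_option linter.unusedSectionVars false

/-! ### Images of Haar measure under homomorphisms -/

section HaarImage

/-- The image of Haar measure under a homomorphism whose range has a dense union of `s.card`
translates is at most `s.card` times Haar measure. -/
theorem map_haarProb_le {G H : Type*} [AddCommGroup G] [TopologicalSpace G]
    [IsTopologicalAddGroup G] [CompactSpace G] [MeasurableSpace G] [BorelSpace G]
    [AddCommGroup H] [TopologicalSpace H] [IsTopologicalAddGroup H] [CompactSpace H] [T2Space H]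
    [SecondCountableTopology H] [MeasurableSpace H] [BorelSpace H]
    (φ : G →+ H) (hφ : Continuous φ) (s : Finset H)
    (hs : Dense {h : H | ∃ t ∈ s, h - t ∈ φ.range}) :
    (haarProb G).map φ ≤ (s.card : ℝ≥0∞) • haarProb H := by
  have hcl : IsClosed (φ.range : Set H) := by
    rw [AddMonoidHom.coe_range]; exact (isCompact_range hφ).isClosed
  -- A finite union of translates of the compact range is closed; being dense, it is everything.
  have hcover : (⋃ t ∈ s, (fun h => -t + h) ⁻¹' (φ.range : Set H)) = Set.univ := by
    have h1 : IsClosed (⋃ t ∈ s, (fun h => -t + h) ⁻¹' (φ.range : Set H)) :=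
      s.finite_toSet.isClosed_biUnion fun t _ => hcl.preimage (by fun_prop)
    rw [← h1.closure_eq]
    refine (hs.mono ?_).closure_eq
    rintro h ⟨t, ht, hh⟩
    simp only [Set.mem_iUnion, Set.mem_preimage]
    exact ⟨t, ht, by rwa [neg_add_eq_sub]⟩
  set W : Set H := (φ.range : Set H) with hW
  have hone : 1 ≤ (s.card : ℝ≥0∞) * haarProb H W := by
    calc (1 : ℝ≥0∞) = haarProb H Set.univ := by simp
      _ ≤ ∑ t ∈ s, haarProb H ((fun h => -t + h) ⁻¹' W) := by
        rw [← hcover]; exact measure_biUnion_finset_le _ _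
      _ = (s.card : ℝ≥0∞) * haarProb H W := by simp [measure_preimage_add]
  have hW0 : haarProb H W ≠ 0 := by
    intro h; simp [h] at hone
  have hWt : haarProb H W ≠ ∞ := measure_ne_top _ _
  have hemb : MeasurableEmbedding (φ.range.subtype) :=
    MeasurableEmbedding.subtype_coe hcl.measurableSet
  have : CompactSpace φ.range := isCompact_iff_compactSpace.mp hcl.isCompact
  have hinv : ((haarProb H).comap φ.range.subtype).IsAddLeftInvariant :=
    Measure.IsAddLeftInvariant.comap _ hemb
  -- By uniqueness of Haar measure, the Haar measure of the range is the normalised restriction of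
  -- that of `H`. The normalising factor is at most `s.card` by `hone`.
  let κ : Measure φ.range := (haarProb H W)⁻¹ • (haarProb H).comap φ.range.subtype
  have hκp : IsProbabilityMeasure κ := by
    refine ⟨?_⟩
    simp only [κ, Measure.smul_apply, smul_eq_mul]
    rw [hemb.comap_apply]
    have : φ.range.subtype '' Set.univ = W := by
      rw [Set.image_univ]; exact Subtype.range_coe
    rw [this, ENNReal.inv_mul_cancel hW0 hWt]
  have : SecondCountableTopology φ.range := inferInstanceAs (SecondCountableTopology W)
  have hκ : κ = haarProb φ.range := by
    have h := Measure.isAddLeftInvariant_eq_smul κ (haarProb φ.range)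
    have h2 : κ Set.univ = 1 := measure_univ
    rw [h] at h2
    simp only [Measure.smul_apply, measure_univ] at h2
    rw [h]
    ext A _
    simp only [Measure.smul_apply, ENNReal.smul_def, smul_eq_mul, mul_one] at h2 ⊢
    rw [h2, one_mul]
  have hrr : (haarProb G).map φ.rangeRestrict = haarProb φ.range :=
    map_haarProb _ (hφ.subtype_mk _) φ.rangeRestrict_surjective
  have hmap : (haarProb G).map φ = κ.map φ.range.subtype := by
    rw [hκ, ← hrr, Measure.map_map hemb.measurable
      (show Continuous φ.rangeRestrict from hφ.subtype_mk _).measurable]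
    rfl
  rw [hmap, Measure.map_smul, hemb.map_comap]
  refine Measure.le_iff.2 fun A hA => ?_
  simp only [Measure.smul_apply, smul_eq_mul]
  refine mul_le_mul' ?_ (Measure.restrict_apply_le _ _)
  rw [ENNReal.inv_le_iff_le_mul (by simp) (by simp)]
  rwa [mul_comm]

theorem haarProb_prod (Z : Type*) [AddCommGroup Z] [TopologicalSpace Z] [IsTopologicalAddGroup Z]
    [CompactSpace Z] [T2Space Z] [SecondCountableTopology Z] [MeasurableSpace Z] [BorelSpace Z] :
    haarProb (Z × Z) = (haarProb Z).prod (haarProb Z) :=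
  Measure.isAddHaarMeasure_eq_of_isProbabilityMeasure _ _

end HaarImage

/-! ### The law of `(x, ξ_i)` and the invariance of `μ̃` -/

section Pair

variable {X Z : Type*} [MeasurableSpace X] [AddCommGroup Z] [TopologicalSpace Z]
  [IsTopologicalAddGroup Z] [CompactSpace Z] [MeasurableSpace Z] [BorelSpace Z]

/-- The coordinates `(p₀, p_i)` of a triple. -/
def pairProj {Y : Type*} (i : Fin 2) (p : Y × Y × Y) : Y × Y := (p.1, ![p.2.1, p.2.2] i)

theorem measurable_pairProj {Y : Type*} [MeasurableSpace Y] (i : Fin 2) :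
    Measurable (pairProj i : Y × Y × Y → Y × Y) := by
  fin_cases i
  · exact measurable_fst.prodMk measurable_snd.fst
  · exact measurable_fst.prodMk measurable_snd.snd

/-- The homomorphism `(z, z₁, z₂) ↦ (z, z_i)` on `Z̃`. -/
def pairHom (α : Z) (a : Fin 2 → ℤ) (i : Fin 2) : kroneckerJoining α a →+ Z × Z where
  toFun w := pairProj i w.1
  map_zero' := by fin_cases i <;> rfl
  map_add' := by fin_cases i <;> intros <;> rfl

theorem continuous_pairHom (α : Z) (a : Fin 2 → ℤ) (i : Fin 2) : Continuous (pairHom α a i) := by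
  fin_cases i
  · exact (continuous_fst.prodMk continuous_snd.fst).comp continuous_subtype_val
  · exact (continuous_fst.prodMk continuous_snd.snd).comp continuous_subtype_val

theorem diagonal_mem_kroneckerJoining (α : Z) (a : Fin 2 → ℤ) (z : Z) :
    (z, z, z) ∈ kroneckerJoining α a := by
  change (z - z, z - z) ∈ orbitClosure α a
  rw [sub_self]
  exact (orbitClosure α a).zero_mem

theorem mem_range_pairHom (α : Z) (a : Fin 2 → ℤ) (i : Fin 2) (z : Z) (q : ℤ) :
    (z, z + q • a i • α) ∈ (pairHom α a i).range := by
  refine ⟨⟨(z, z + q • a 0 • α, z + q • a 1 • α), ?_⟩, ?_⟩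
  · change (z + q • a 0 • α - z, z + q • a 1 • α - z) ∈ orbitClosure α a
    simp only [add_sub_cancel_left]
    exact AddSubgroup.le_topologicalClosure _ ⟨q, rfl⟩
  · fin_cases i <;> rfl

variable [T2Space Z] [SecondCountableTopology Z]

/-- Division by `a_i` puts each `(z, z + n α)` into the translate of the range by `(0, j α)`, where
`j` is the residue of `n`. There are `|a_i|` residues, and such points are dense. -/
theorem map_pairHom_le {α : Z} (hα : Dense (AddSubgroup.zmultiples α : Set Z)) (a : Fin 2 → ℤ)
    (i : Fin 2) (hi : a i ≠ 0) :
    (haarProb (kroneckerJoining α a)).map (pairHom α a i) ≤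
      ((a i).natAbs : ℝ≥0∞) • haarProb (Z × Z) := by
  classical
  let s : Finset (Z × Z) := (Finset.range (a i).natAbs).image fun j : ℕ => (0, j • α)
  -- A continuous surjective shear maps the dense set `Z × ℤα` to a dense set.
  have hd : Dense ((fun p : Z × Z => (p.1, p.1 + p.2)) ''
      (Set.univ ×ˢ (AddSubgroup.zmultiples α : Set Z))) := by
    refine DenseRange.dense_image ?_ (by fun_prop) (dense_univ.prod hα)
    refine Function.Surjective.denseRange fun p => ⟨(p.1, p.2 - p.1), by simp⟩
  refine (map_haarProb_le (pairHom α a i) (continuous_pairHom α a i) s (hd.mono ?_)).trans ?_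
  · rintro _ ⟨⟨z, _⟩, ⟨-, n, rfl⟩, rfl⟩
    refine ⟨(0, (n % a i).toNat • α), ?_, ?_⟩
    · refine Finset.mem_image.2 ⟨(n % a i).toNat, Finset.mem_range.2 ?_, rfl⟩
      have h1 := Int.emod_nonneg n hi
      have h2 := Int.emod_lt_abs n hi
      rw [Int.abs_eq_natAbs] at h2
      omega
    · have h1 := Int.emod_nonneg n hi
      have h3 : ((z, z + n • α) : Z × Z) - (0, (n % a i).toNat • α)
          = (z, z + (n / a i) • a i • α) := by
        rw [← natCast_zsmul, Int.toNat_of_nonneg h1, smul_smul]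
        ext
        · simp
        · simp only [Prod.snd_sub]
          rw [add_sub_assoc, ← sub_smul]
          congr 2
          have := Int.emod_add_mul_ediv n (a i)
          linarith [mul_comm (a i) (n / a i)]
      change ((z, z + n • α) : Z × Z) - (0, (n % a i).toNat • α) ∈ _
      rw [h3]
      exact mem_range_pairHom α a i z _
  · refine Measure.le_iff.2 fun A _ => ?_
    simp only [Measure.smul_apply, smul_eq_mul]
    gcongr
    simpa using Finset.card_image_le (s := Finset.range (a i).natAbs)
      (f := fun j : ℕ => ((0, j • α) : Z × Z))

variable [StandardBorelSpace X] [Nonempty X] (μ : Measure X) [IsProbabilityMeasure μ]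

theorem lintegral_disintegration {π : X → Z} (hπ : MeasurePreserving π μ (haarProb Z)) {A : Set X}
    (hA : MeasurableSet A) : ∫⁻ z, disintegration μ π z A ∂haarProb Z = μ A := by
  have h := compProd_map_condDistrib (mβ := inferInstance) (μ := μ) (X := π) (Y := (id : X → X))
    aemeasurable_id
  have h2 := congrArg (fun m : Measure (Z × X) => m (Set.univ ×ˢ A)) h
  simp only [Measure.compProd_apply_prod MeasurableSet.univ hA, hπ.map_eq] at h2
  rw [Measure.map_apply (hπ.measurable.prodMk measurable_id) (MeasurableSet.univ.prod hA)] at h2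
  simpa [disintegration, Set.mk_preimage_prod] using h2

theorem bind_parallelComp_disintegration {π : X → Z} (hπ : MeasurePreserving π μ (haarProb Z)) :
    (haarProb (Z × Z)).bind (disintegration μ π ∥ₖ disintegration μ π) = μ.prod μ := by
  symm
  refine Measure.prod_eq fun A B hA hB => ?_
  rw [Measure.bind_apply (hA.prod hB) (Kernel.aemeasurable _), haarProb_prod]
  simp only [Kernel.parallelComp_apply, Measure.prod_prod]
  rw [lintegral_prod_mul (f := fun z => disintegration μ π z A)
      (g := fun z => disintegration μ π z B)
      (Kernel.measurable_coe _ hA).aemeasurable (Kernel.measurable_coe _ hB).aemeasurable,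
    lintegral_disintegration μ hπ hA, lintegral_disintegration μ hπ hB]

/-- Fibrewise the three coordinates are independent, so forgetting one leaves the product of the
other two. -/
theorem map_pairProj_joiningMeasure (π : X → Z) (α : Z) (a : Fin 2 → ℤ) (i : Fin 2) :
    (joiningMeasure μ π α a).map (pairProj i) =
      ((haarProb (kroneckerJoining α a)).map (pairHom α a i)).bind
        (disintegration μ π ∥ₖ disintegration μ π) := by
  ext A hA
  rw [Measure.map_apply (measurable_pairProj i) hA, joiningMeasure,
    Measure.bind_apply (measurable_pairProj i hA) (measurable_joiningKernel μ π α a).aemeasurable,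
    Measure.bind_apply hA (Kernel.aemeasurable _),
    lintegral_map (Kernel.measurable_coe _ hA) (continuous_pairHom α a i).measurable]
  refine lintegral_congr fun w => ?_
  rw [← Measure.map_apply (measurable_pairProj i) hA, Kernel.parallelComp_apply]
  congr 1
  fin_cases i
  · change Measure.map (Prod.map id Prod.fst) _ = _
    rw [← Measure.map_prod_map _ _ measurable_id measurable_fst, Measure.map_id,
      Measure.map_fst_prod]
    simp [pairHom, pairProj]
  · change Measure.map (Prod.map id Prod.snd) _ = _
    rw [← Measure.map_prod_map _ _ measurable_id measurable_snd, Measure.map_id,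
      Measure.map_snd_prod]
    simp [pairHom, pairProj]

/-- The law of `(x, ξ_i)` under `μ̃` is at most `|a_i|` times `μ ⊗ μ`. -/
theorem map_pairProj_joiningMeasure_le {π : X → Z} (hπ : MeasurePreserving π μ (haarProb Z))
    {α : Z} (hα : Dense (AddSubgroup.zmultiples α : Set Z)) (a : Fin 2 → ℤ) (i : Fin 2)
    (hi : a i ≠ 0) :
    (joiningMeasure μ π α a).map (pairProj i) ≤ ((a i).natAbs : ℝ≥0∞) • μ.prod μ := by
  rw [map_pairProj_joiningMeasure, ← bind_parallelComp_disintegration μ hπ]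
  refine Measure.le_iff.2 fun A hA => ?_
  rw [Measure.smul_apply, Measure.bind_apply hA (Kernel.aemeasurable _),
    Measure.bind_apply hA (Kernel.aemeasurable _), ← lintegral_smul_measure]
  exact lintegral_mono' (map_pairHom_le hα a i hi) le_rfl

/-- Invariance of `μ` and equivariance of `π` make `z ↦ T_* μ_{z - α}` another disintegration of `μ`
over `π`; almost everywhere uniqueness identifies the two. -/
theorem map_disintegration {π : X → Z} (hπ : MeasurePreserving π μ (haarProb Z)) {T : X ≃ᵐ X}
    (hT : MeasurePreserving T μ μ) {α : Z} (he : ∀ᵐ x ∂μ, π (T x) = π x + α) :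
    ∀ᵐ z ∂haarProb Z, (disintegration μ π z).map T = disintegration μ π (z + α) := by
  let κ : Kernel Z X := ((disintegration μ π).comap (fun z => z - α) (by fun_prop)).map T
  have : IsMarkovKernel κ := Kernel.IsMarkovKernel.map _ T.measurable
  have hrot : MeasurePreserving (fun z : Z => z + α) (haarProb Z) (haarProb Z) :=
    measurePreserving_add_right _ α
  have hb : μ.map (fun x => (π x, id x)) = haarProb Z ⊗ₘ disintegration μ π := by
    have h := compProd_map_condDistrib (mβ := inferInstance) (μ := μ) (X := π)
      (Y := (id : X → X)) aemeasurable_id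
    rw [hπ.map_eq] at h
    exact h.symm
  have key : μ.map (fun x => (π x, id x)) = μ.map π ⊗ₘ κ := by
    rw [hπ.map_eq]
    have h1 : μ.map (fun x => (π x, id x)) =
        (μ.map (fun x => (π x, id x))).map (Prod.map (· + α) T) := by
      rw [Measure.map_map (by fun_prop) (hπ.measurable.prodMk measurable_id)]
      nth_rewrite 1 [← hT.map_eq]
      rw [Measure.map_map (hπ.measurable.prodMk measurable_id) T.measurable]
      refine Measure.map_congr ?_
      filter_upwards [he] with x hx
      simp [hx]
    rw [h1, hb]
    ext A hA
    rw [Measure.map_apply (by fun_prop) hA, Measure.compProd_apply hA,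
      Measure.compProd_apply (hA.preimage (by fun_prop))]
    nth_rewrite 2 [← hrot.map_eq]
    rw [lintegral_map (Kernel.measurable_kernel_prodMk_left hA) (by fun_prop)]
    refine lintegral_congr fun z => ?_
    simp only [κ]
    rw [Kernel.map_apply' _ T.measurable _ (measurable_prodMk_left hA), Kernel.comap_apply]
    simp only [add_sub_cancel_right]
    rfl
  have h := condDistrib_ae_eq_of_measure_eq_compProd (μ := μ) (Y := id) π aemeasurable_id key
  rw [hπ.map_eq] at h
  filter_upwards [hrot.quasiMeasurePreserving.ae h] with z hz
  rw [disintegration, hz]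
  simp only [κ]
  rw [Kernel.map_apply _ T.measurable, Kernel.comap_apply]
  simp [disintegration]

/-- The measure `μ̃` is invariant under `T̃`. -/
theorem measurePreserving_joiningMap {π : X → Z} (hπ : MeasurePreserving π μ (haarProb Z))
    {T : X ≃ᵐ X} (hT : MeasurePreserving T μ μ) {α : Z} (he : ∀ᵐ x ∂μ, π (T x) = π x + α)
    (a : Fin 2 → ℤ) :
    MeasurePreserving (joiningMap T) (joiningMeasure μ π α a) (joiningMeasure μ π α a) := by
  refine ⟨(joiningMap T).measurable, ?_⟩
  have hd := map_disintegration μ hπ hT he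
  have key : ∀ φ : kroneckerJoining α a →+ Z, Continuous φ →
      (∀ z, φ ⟨(z, z, z), diagonal_mem_kroneckerJoining α a z⟩ = z) →
      ∀ᵐ w ∂(haarProb (kroneckerJoining α a)),
        (disintegration μ π (φ w)).map T = disintegration μ π (φ w + α) := by
    intro φ hφ hz
    rw [← map_haarProb φ hφ (fun z => ⟨_, hz z⟩)] at hd
    exact ae_of_ae_map hφ.measurable.aemeasurable hd
  have h0 := key ((AddMonoidHom.fst Z (Z × Z)).comp (kroneckerJoining α a).subtype)
    (by simpa using continuous_fst.comp continuous_subtype_val) (fun _ => rfl)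
  have h1 := key (((AddMonoidHom.fst Z Z).comp (AddMonoidHom.snd Z (Z × Z))).comp
    (kroneckerJoining α a).subtype)
    (continuous_fst.comp (continuous_snd.comp continuous_subtype_val)) (fun _ => rfl)
  have h2 := key (((AddMonoidHom.snd Z Z).comp (AddMonoidHom.snd Z (Z × Z))).comp
    (kroneckerJoining α a).subtype)
    (continuous_snd.comp (continuous_snd.comp continuous_subtype_val)) (fun _ => rfl)
  have hm := measurable_joiningKernel μ π α a
  ext A hA
  have hA' : MeasurableSet (joiningMap T ⁻¹' A) := (joiningMap T).measurable hA
  rw [Measure.map_apply (joiningMap T).measurable hA, joiningMeasure,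
    Measure.bind_apply hA' hm.aemeasurable, Measure.bind_apply hA hm.aemeasurable]
  -- On the base, `T̃` acts as translation by the diagonal element `δ` of `Z̃`, which preserves Haar
  -- measure.
  let δ : kroneckerJoining α a := ⟨(α, α, α), diagonal_mem_kroneckerJoining α a α⟩
  rw [← lintegral_add_right_eq_self (μ := haarProb (kroneckerJoining α a)) (fun w =>
    ((disintegration μ π w.1.1).prod ((disintegration μ π w.1.2.1).prod
      (disintegration μ π w.1.2.2))) A) δ]
  refine lintegral_congr_ae ?_
  filter_upwards [h0, h1, h2] with w w0 w1 w2
  change Measure.map T (disintegration μ π w.1.1) = disintegration μ π (w.1.1 + α) at w0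
  change Measure.map T (disintegration μ π w.1.2.1) = disintegration μ π (w.1.2.1 + α) at w1
  change Measure.map T (disintegration μ π w.1.2.2) = disintegration μ π (w.1.2.2 + α) at w2
  change _ = ((disintegration μ π (w.1.1 + α)).prod ((disintegration μ π (w.1.2.1 + α)).prod
    (disintegration μ π (w.1.2.2 + α)))) A
  rw [← Measure.map_apply (joiningMap T).measurable hA, ← w0, ← w1, ← w2,
    Measure.map_prod_map _ _ T.measurable T.measurable,
    Measure.map_prod_map _ _ T.measurable (by fun_prop)]
  rfl

end Pair

/-! ### Integer powers of a transformation -/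

section Iter

variable {X : Type*} [MeasurableSpace X] (T : X ≃ᵐ X)

@[simp]
theorem iter_zero (x : X) : iter T 0 x = x := rfl

@[simp]
theorem iter_one (x : X) : iter T 1 x = T x := by
  simp [iter]

theorem iter_add (m n : ℤ) (x : X) : iter T (m + n) x = iter T m (iter T n x) := by
  simp [iter, zpow_add]

theorem iter_neg_one (x : X) : iter T (-1) x = T.symm x := by
  simp only [iter, zpow_neg, zpow_one]
  rfl

theorem iter_iterate (c : ℤ) (n : ℕ) : (iter T c)^[n] = iter T (c * n) := by
  induction n with
  | zero => funext x; simp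
  | succ n ih =>
    funext x
    rw [Function.iterate_succ_apply, ih, ← iter_add]
    push_cast
    ring_nf

variable {T}

theorem measurePreserving_iter {μ : Measure X} (hT : MeasurePreserving T μ μ) (n : ℤ) :
    MeasurePreserving (iter T n) μ μ := by
  induction n using Int.induction_on with
  | zero => exact MeasurePreserving.id μ
  | succ n ih =>
    have h : iter T (n + 1) = iter T n ∘ T := by funext x; simp [iter_add]
    rw [h]; exact ih.comp hT
  | pred n ih =>
    have h : iter T (-n - 1) = iter T (-n) ∘ T.symm := by
      funext x; simp [sub_eq_add_neg, iter_add, iter_neg_one]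
    rw [h]; exact ih.comp (hT.symm T)

theorem iter_joiningMap (n : ℤ) (p : X × X × X) :
    iter (joiningMap T) n p = (iter T n p.1, iter T n p.2.1, iter T n p.2.2) := by
  induction n using Int.induction_on generalizing p with
  | zero => rfl
  | succ n ih => rw [iter_add, ih]; simp only [iter_add, iter_one]; rfl
  | pred n ih =>
    rw [sub_eq_add_neg, iter_add, ih]
    simp only [iter_add, iter_neg_one]; rfl

end Iter

/-! ### Centered means and their upper limits -/

section CenteredMean

/-- The mean of `s h` over `|h| ≤ H`. -/
noncomputable def centeredMean (s : ℤ → ℝ) (H : ℕ) : ℝ :=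
  (2 * (H : ℝ) + 1)⁻¹ * ∑ h ∈ Finset.Icc (-(H : ℤ)) (H : ℤ), s h

theorem centeredMean_const (K : ℝ) (H : ℕ) : centeredMean (fun _ => K) H = K := by
  have h : ((Finset.Icc (-(H : ℤ)) (H : ℤ)).card : ℝ) = 2 * (H : ℝ) + 1 := by
    rw [Int.card_Icc]
    have : ((H : ℤ) + 1 - -(H : ℤ)).toNat = 2 * H + 1 := by omega
    rw [this]; push_cast; ring
  rw [centeredMean, Finset.sum_const, nsmul_eq_mul, h]
  field_simp

theorem centeredMean_mono {s t : ℤ → ℝ} (h : ∀ n, s n ≤ t n) (H : ℕ) :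
    centeredMean s H ≤ centeredMean t H := by
  unfold centeredMean
  gcongr with n _
  exact h n

theorem centeredMean_const_mul (D : ℝ) (s : ℤ → ℝ) (H : ℕ) :
    centeredMean (fun n => D * s n) H = D * centeredMean s H := by
  rw [centeredMean, centeredMean, ← Finset.mul_sum]; ring

variable {s t : ℤ → ℝ} {K D : ℝ}

theorem centeredMean_nonneg (h : ∀ n, 0 ≤ s n) (H : ℕ) : 0 ≤ centeredMean s H := by
  rw [← centeredMean_const 0 H]; exact centeredMean_mono h H

theorem centeredMean_le (h : ∀ n, s n ≤ K) (H : ℕ) : centeredMean s H ≤ K := by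
  rw [← centeredMean_const K H]; exact centeredMean_mono h H

theorem isBoundedUnder_centeredMean (h : ∀ n, s n ≤ K) :
    IsBoundedUnder (· ≤ ·) atTop (centeredMean s) :=
  isBoundedUnder_of ⟨K, centeredMean_le h⟩

theorem isCoboundedUnder_centeredMean (h : ∀ n, 0 ≤ s n) :
    IsCoboundedUnder (· ≤ ·) atTop (centeredMean s) :=
  (isBoundedUnder_of ⟨0, centeredMean_nonneg h⟩ :
    IsBoundedUnder (· ≥ ·) atTop (centeredMean s)).isCoboundedUnder_le

theorem limsup_centeredMean_nonneg (h0 : ∀ n, 0 ≤ s n) (h : ∀ n, s n ≤ K) :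
    0 ≤ limsup (centeredMean s) atTop :=
  le_limsup_of_frequently_le (Frequently.of_forall (centeredMean_nonneg h0))
    (isBoundedUnder_centeredMean h)

theorem limsup_centeredMean_le (h0 : ∀ n, 0 ≤ s n) (h : ∀ n, s n ≤ K) :
    limsup (centeredMean s) atTop ≤ K :=
  limsup_le_of_le (isCoboundedUnder_centeredMean h0) (Eventually.of_forall (centeredMean_le h))

theorem limsup_centeredMean_le_const_mul (h0 : ∀ n, 0 ≤ s n) (ht0 : ∀ n, 0 ≤ t n)
    (ht : ∀ n, t n ≤ K) (hD : 0 ≤ D) (hst : ∀ n, s n ≤ D * t n) :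
    limsup (centeredMean s) atTop ≤ D * limsup (centeredMean t) atTop := by
  have h1 : D * limsup (centeredMean t) atTop = limsup (fun H => D * centeredMean t H) atTop :=
    Monotone.map_limsup_of_continuousAt (f := fun x : ℝ => D * x)
      (fun x y h => mul_le_mul_of_nonneg_left h hD) (centeredMean t)
      (continuous_const.mul continuous_id).continuousAt (isBoundedUnder_centeredMean ht)
      (isCoboundedUnder_centeredMean ht0)
  rw [h1]
  refine limsup_le_limsup (Eventually.of_forall fun H => ?_) (isCoboundedUnder_centeredMean h0)
    (isBoundedUnder_of ⟨D * K, fun H => mul_le_mul_of_nonneg_left (centeredMean_le ht H) hD⟩)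
  change _ ≤ D * centeredMean t H
  rw [← centeredMean_const_mul]
  exact centeredMean_mono hst H

end CenteredMean

/-! ### Bounds for the uniformity seminorms -/

section Seminorm

variable {X 𝕜 : Type*} [MeasurableSpace X] [RCLike 𝕜] {μ : Measure X} {T : X ≃ᵐ X}

/-- The multiplicative derivative `conj f · f ∘ T^h`. -/
noncomputable def mulDeriv (T : X ≃ᵐ X) (f : X → 𝕜) (h : ℤ) (x : X) : 𝕜 :=
  conj (f x) * f (iter T h x)

theorem uniformitySeminorm_add_two (c : ℤ) (l : ℕ) (f : X → 𝕜) :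
    uniformitySeminorm μ T c (l + 2) f =
      limsup (centeredMean fun h => uniformitySeminorm μ T c (l + 1) (mulDeriv T f h)
        ^ (2 ^ (l + 1))) atTop ^ ((1 : ℝ) / 2 ^ (l + 2)) := rfl

theorem norm_mulDeriv_le (hT : MeasurePreserving T μ μ) {f : X → 𝕜} {K : ℝ}
    (hf : ∀ᵐ x ∂μ, ‖f x‖ ≤ K) (h : ℤ) : ∀ᵐ x ∂μ, ‖mulDeriv T f h x‖ ≤ K ^ 2 := by
  filter_upwards [hf, (measurePreserving_iter hT h).quasiMeasurePreserving.ae hf] with x h1 h2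
  rw [mulDeriv, norm_mul, RCLike.norm_conj, pow_two]
  exact mul_le_mul h1 h2 (norm_nonneg _) ((norm_nonneg _).trans h1)

theorem memLp_mulDeriv (hT : MeasurePreserving T μ μ) {f : X → 𝕜} (hf : MemLp f ∞ μ) (h : ℤ) :
    MemLp (mulDeriv T f h) ∞ μ :=
  (hf.comp_measurePreserving (measurePreserving_iter hT h)).mul hf.star

theorem rpow_one_div_two_pow_pow {x : ℝ} (hx : 0 ≤ x) (n : ℕ) :
    (x ^ ((1 : ℝ) / 2 ^ n)) ^ (2 ^ n) = x := by
  have := Real.rpow_inv_natCast_pow hx (n := 2 ^ n) (by positivity)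
  simpa using this

variable [IsProbabilityMeasure μ]

/-- A real `limsup` obeys the usual rules only for bounded sequences. This a priori bound supplies
the boundedness at every level of the recursion. -/
theorem uniformitySeminorm_mem_Icc (hT : MeasurePreserving T μ μ) (c : ℤ) (l : ℕ) {f : X → 𝕜}
    {K : ℝ} (hK : 0 ≤ K) (hf : ∀ᵐ x ∂μ, ‖f x‖ ≤ K) :
    uniformitySeminorm μ T c l f ∈ Set.Icc 0 K := by
  induction l using Nat.twoStepInduction generalizing f K with
  | zero => exact ⟨le_rfl, hK⟩
  | one =>
    refine ⟨ENNReal.toReal_nonneg, ENNReal.toReal_le_of_le_ofReal hK ?_⟩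
    refine (eLpNorm_condExp_le_eLpNorm f (by norm_num)).trans ?_
    simpa using eLpNorm_le_of_ae_bound (p := 2) hf
  | more l _ ih =>
    have h1 : ∀ h, uniformitySeminorm μ T c (l + 1) (mulDeriv T f h) ^ (2 ^ (l + 1)) ∈
        Set.Icc 0 (K ^ 2 ^ (l + 2)) := fun h => by
      obtain ⟨h2, h3⟩ := ih (sq_nonneg K) (norm_mulDeriv_le hT hf h)
      refine ⟨by positivity, (pow_le_pow_left₀ h2 h3 _).trans_eq ?_⟩
      rw [← pow_mul]; ring_nf
    have h0 := limsup_centeredMean_nonneg (fun h => (h1 h).1) (fun h => (h1 h).2)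
    rw [uniformitySeminorm_add_two]
    refine ⟨by positivity, ?_⟩
    refine le_of_pow_le_pow_left₀ (n := 2 ^ (l + 2)) (by positivity) hK ?_
    rw [rpow_one_div_two_pow_pow h0]
    exact limsup_centeredMean_le (fun h => (h1 h).1) (fun h => (h1 h).2)

theorem uniformitySeminorm_mulDeriv_pow_mem_Icc (hT : MeasurePreserving T μ μ) (c : ℤ) (l : ℕ)
    {f : X → 𝕜} {K : ℝ} (hf : ∀ᵐ x ∂μ, ‖f x‖ ≤ K) (h : ℤ) (n : ℕ) :
    uniformitySeminorm μ T c l (mulDeriv T f h) ^ n ∈ Set.Icc 0 ((K ^ 2) ^ n) := by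
  obtain ⟨h2, h3⟩ := uniformitySeminorm_mem_Icc hT c l (sq_nonneg K) (norm_mulDeriv_le hT hf h)
  exact ⟨by positivity, pow_le_pow_left₀ h2 h3 _⟩

theorem uniformitySeminorm_add_two_pow (hT : MeasurePreserving T μ μ) (c : ℤ) (l : ℕ)
    {f : X → 𝕜} {K : ℝ} (hf : ∀ᵐ x ∂μ, ‖f x‖ ≤ K) :
    uniformitySeminorm μ T c (l + 2) f ^ 2 ^ (l + 2) =
      limsup (centeredMean fun h => uniformitySeminorm μ T c (l + 1) (mulDeriv T f h)
        ^ (2 ^ (l + 1))) atTop := by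
  have h1 := fun h => uniformitySeminorm_mulDeriv_pow_mem_Icc hT c (l + 1) hf h (2 ^ (l + 1))
  rw [uniformitySeminorm_add_two, rpow_one_div_two_pow_pow
    (limsup_centeredMean_nonneg (fun h => (h1 h).1) (fun h => (h1 h).2))]

end Seminorm

/-! ### Conditional expectation on invariant sets and ergodic means -/

section ConditionalExpectation

variable {Y 𝕜 : Type*} [MeasurableSpace Y] [RCLike 𝕜] {ν : Measure Y} [IsProbabilityMeasure ν]

/-- An `S`-invariant set is its own preimage under `S^[n]`, so a change of variables leaves
integrals over it unchanged. -/
theorem condExp_invariants_comp_iterate {S : Y → Y} (hS : MeasurePreserving S ν ν) {F : Y → 𝕜}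
    (hF : Integrable F ν) (n : ℕ) :
    ν[F ∘ S^[n] | MeasurableSpace.invariants S] =ᵐ[ν] ν[F | MeasurableSpace.invariants S] := by
  have hn := hS.iterate n
  symm
  refine ae_eq_condExp_of_forall_setIntegral_eq (MeasurableSpace.invariants_le S)
    (hn.integrable_comp_of_integrable hF) (fun _ _ _ => integrable_condExp.integrableOn)
    (fun A hA _ => ?_) stronglyMeasurable_condExp.aestronglyMeasurable
  rw [setIntegral_condExp (MeasurableSpace.invariants_le S) hF hA]
  have hA' := MeasurableSpace.le_invariants_iterate S n A hA
  have h1 : ∫ y in A, F y ∂ν = ∫ y in A, F y ∂(ν.map S^[n]) := by rw [hn.map_eq]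
  rw [h1, setIntegral_map hA.1 (by rw [hn.map_eq]; exact hF.1) hn.measurable.aemeasurable, hA'.2]
  rfl

/-- The conditional expectation on the invariant sets is dominated by ergodic means. -/
theorem eLpNorm_condExp_invariants_le {S : Y → Y} (hS : MeasurePreserving S ν ν) {F : Y → 𝕜}
    (hF : Integrable F ν) {N : ℕ} (hN : 0 < N) :
    eLpNorm (ν[F | MeasurableSpace.invariants S]) 2 ν ≤
      eLpNorm (fun y => (N : 𝕜)⁻¹ * ∑ n ∈ Finset.range N, F (S^[n] y)) 2 ν := by
  let A : Y → 𝕜 := (N : 𝕜)⁻¹ • ∑ n ∈ Finset.range N, F ∘ S^[n]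
  have hA : A = fun y => (N : 𝕜)⁻¹ * ∑ n ∈ Finset.range N, F (S^[n] y) := by
    funext y; simp [A]
  -- All `F ∘ S^[n]` share the conditional expectation of `F`, hence so does their mean `A`;
  -- conditional expectation then contracts `L²`.
  have h1 : ν[A | MeasurableSpace.invariants S] =ᵐ[ν] ν[F | MeasurableSpace.invariants S] := by
    refine (condExp_smul _ _ _).trans ?_
    have h2 : ν[∑ n ∈ Finset.range N, F ∘ S^[n] | MeasurableSpace.invariants S] =ᵐ[ν]
        ∑ n ∈ Finset.range N, ν[F ∘ S^[n] | MeasurableSpace.invariants S] :=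
      condExp_finsetSum (fun n _ => (hS.iterate n).integrable_comp_of_integrable hF) _
    have h3 : ∀ᵐ y ∂ν, ∀ n ∈ Finset.range N,
        (ν[F ∘ S^[n] | MeasurableSpace.invariants S]) y =
          (ν[F | MeasurableSpace.invariants S]) y :=
      (ae_ball_iff (Finset.range N).countable_toSet).2 fun n _ =>
        condExp_invariants_comp_iterate hS hF n
    filter_upwards [h2, h3] with y h2 h3
    rw [Pi.smul_apply, h2, Finset.sum_apply, Finset.sum_congr rfl h3]
    have : (N : 𝕜) ≠ 0 := by exact_mod_cast hN.ne'
    simp [this]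
  rw [← hA, ← eLpNorm_congr_ae h1]
  exact eLpNorm_condExp_le_eLpNorm A (by norm_num)

end ConditionalExpectation

/-- Conditioning keeps the integral, and `L¹ ≤ L²` on a probability space. -/
theorem norm_integral_le_eLpNorm_condExp {Y 𝕜 : Type*} [RCLike 𝕜] {m m0 : MeasurableSpace Y}
    {ν : Measure Y} [IsProbabilityMeasure ν] (hm : m ≤ m0) {g : Y → 𝕜} (hg : MemLp g 2 ν) :
    ‖∫ y, g y ∂ν‖ ≤ (eLpNorm (ν[g | m]) 2 ν).toReal := by
  have h2 : MemLp (ν[g | m]) 2 ν := hg.condExp (by norm_num)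
  rw [← integral_condExp hm]
  refine (norm_integral_le_integral_norm _).trans ?_
  rw [integral_norm_eq_lintegral_enorm h2.1, ← eLpNorm_one_eq_lintegral_enorm]
  exact ENNReal.toReal_mono h2.2.ne
    (eLpNorm_le_eLpNorm_of_exponent_le (by norm_num) h2.1)

theorem eLpNorm_two_toReal_sq {Y 𝕜 : Type*} [MeasurableSpace Y] [RCLike 𝕜] {ν : Measure Y}
    {g : Y → 𝕜} (hg : MemLp g 2 ν) :
    (eLpNorm g 2 ν).toReal ^ 2 = ∫ y, ‖g y‖ ^ 2 ∂ν := by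
  have h := hg.eLpNorm_eq_integral_rpow_norm (by norm_num) (by norm_num)
  rw [h, ENNReal.toReal_ofReal (by positivity), ← Real.rpow_natCast, ← Real.rpow_mul]
  · simp
  · exact integral_nonneg fun y => by positivity

/-! ### Means of tensor squares and correlations -/

section TensorMean

variable {X 𝕜 : Type*} [MeasurableSpace X] [RCLike 𝕜] {μ : Measure X} [IsProbabilityMeasure μ]

theorem memLp_tensorMean {u : ℕ → X → 𝕜} (hu : ∀ n, MemLp (u n) ∞ μ) (N : ℕ) :
    MemLp (fun p : X × X => (N : 𝕜)⁻¹ * ∑ n ∈ Finset.range N, u n p.1 * u n p.2) ∞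
      (μ.prod μ) := by
  have h : ∀ n ∈ Finset.range N, MemLp (fun p : X × X => u n p.1 * u n p.2) ∞ (μ.prod μ) :=
    fun n _ => ((hu n).comp_measurePreserving measurePreserving_snd).mul
      ((hu n).comp_measurePreserving measurePreserving_fst)
  exact (memLp_finsetSum _ h).const_mul _

/-- After expanding the square, Fubini splits each cross term into two equal integrals, one per
variable. The result is a sum of squares of complex correlations, bounded by the triangle
inequality. -/
theorem integral_norm_sq_tensorMean_le {u : ℕ → X → 𝕜} (hu : ∀ n, MemLp (u n) ∞ μ) (N : ℕ) :
    ∫ p, ‖(N : 𝕜)⁻¹ * ∑ n ∈ Finset.range N, u n p.1 * u n p.2‖ ^ 2 ∂μ.prod μ ≤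
      ((N : ℝ) ^ 2)⁻¹ * ∑ m ∈ Finset.range N, ∑ n ∈ Finset.range N,
        ‖∫ x, conj (u m x) * u n x ∂μ‖ ^ 2 := by
  have hint : ∀ m n, Integrable (fun x => conj (u m x) * u n x) μ := fun m n =>
    ((hu n).mul (hu m).star : MemLp _ ∞ μ).integrable (by simp)
  have key : ((∫ p, ‖(N : 𝕜)⁻¹ * ∑ n ∈ Finset.range N, u n p.1 * u n p.2‖ ^ 2 ∂μ.prod μ : ℝ) : 𝕜)
      = ((N : 𝕜) ^ 2)⁻¹ * ∑ m ∈ Finset.range N, ∑ n ∈ Finset.range N,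
        (∫ x, conj (u m x) * u n x ∂μ) ^ 2 := by
    have hpt : ∀ p : X × X,
        ((‖(N : 𝕜)⁻¹ * ∑ n ∈ Finset.range N, u n p.1 * u n p.2‖ ^ 2 : ℝ) : 𝕜) =
        ((N : 𝕜) ^ 2)⁻¹ * ∑ m ∈ Finset.range N, ∑ n ∈ Finset.range N,
          (conj (u m p.1) * u n p.1) * (conj (u m p.2) * u n p.2) := by
      intro p
      push_cast
      rw [← RCLike.conj_mul, map_mul, map_inv₀, map_natCast, map_sum, mul_mul_mul_comm,
        ← mul_inv, ← pow_two, Finset.sum_mul_sum]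
      congr 1
      refine Finset.sum_congr rfl fun m _ => Finset.sum_congr rfl fun n _ => ?_
      rw [map_mul]; ring
    rw [← integral_ofReal]
    simp_rw [hpt]
    rw [integral_const_mul, integral_finsetSum _ fun m _ =>
      integrable_finsetSum _ fun n _ => (hint m n).mul_prod (hint m n)]
    congr 1
    refine Finset.sum_congr rfl fun m _ => ?_
    rw [integral_finsetSum _ fun n _ => (hint m n).mul_prod (hint m n)]
    refine Finset.sum_congr rfl fun n _ => ?_
    rw [integral_prod_mul (fun x => conj (u m x) * u n x) (fun x => conj (u m x) * u n x), pow_two]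
  refine (le_abs_self _).trans ?_
  rw [← RCLike.norm_ofReal (K := 𝕜), key, norm_mul, norm_inv, norm_pow, RCLike.norm_natCast]
  gcongr
  refine (norm_sum_le _ _).trans (Finset.sum_le_sum fun m _ => ?_)
  refine (norm_sum_le _ _).trans (Finset.sum_le_sum fun n _ => ?_)
  rw [norm_pow]

end TensorMean

/-- The mean of `s (c (n - m))` over `0 ≤ m, n < N` is dominated by a centered mean. -/
theorem sum_sum_sub_le_centeredMean {s : ℤ → ℝ} (hs : ∀ n, 0 ≤ s n) {c N : ℕ} (hc : 0 < c)
    (hN : 0 < N) :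
    ((N : ℝ) ^ 2)⁻¹ * ∑ m ∈ Finset.range N, ∑ n ∈ Finset.range N, s (c * ((n : ℤ) - m)) ≤
      3 * c * centeredMean s (c * N) := by
  have h1 : ∀ m ∈ Finset.range N, ∑ n ∈ Finset.range N, s (c * ((n : ℤ) - m)) ≤
      (2 * ((c * N : ℕ) : ℝ) + 1) * centeredMean s (c * N) := by
    intro m hm
    have h2 : (2 * ((c * N : ℕ) : ℝ) + 1) * centeredMean s (c * N) =
        ∑ h ∈ Finset.Icc (-((c * N : ℕ) : ℤ)) ((c * N : ℕ) : ℤ), s h := by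
      rw [centeredMean, mul_inv_cancel_left₀ (by positivity)]
    -- For fixed `m`, distinct `n` give distinct times `c (n - m)` in `[-cN, cN]`, so nonnegativity
    -- bounds the inner sum by the full sum over that interval.
    have hinj : Set.InjOn (fun n : ℕ => (c : ℤ) * ((n : ℤ) - m)) (Finset.range N) := by
      intro x _ y _ hxy
      have hc' : (c : ℤ) ≠ 0 := by exact_mod_cast hc.ne'
      have := mul_left_cancel₀ hc' hxy
      omega
    rw [h2, ← Finset.sum_image (f := s) hinj]
    refine Finset.sum_le_sum_of_subset_of_nonneg (fun h hh => ?_) fun h _ _ => hs h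
    obtain ⟨n, hn, rfl⟩ := Finset.mem_image.1 hh
    rw [Finset.mem_range] at hm hn
    rw [Finset.mem_Icc]
    push_cast
    constructor
    · rw [← mul_neg]
      exact mul_le_mul_of_nonneg_left (by omega) (by positivity)
    · exact mul_le_mul_of_nonneg_left (by omega) (by positivity)
  have h0 := centeredMean_nonneg hs (c * N)
  have hN1 : (1 : ℝ) ≤ N := by exact_mod_cast hN
  have hc1 : (1 : ℝ) ≤ c := by exact_mod_cast hc
  have h3 := Finset.sum_le_sum h1
  rw [Finset.sum_const, Finset.card_range, nsmul_eq_mul] at h3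
  rw [inv_mul_le_iff₀ (by positivity)]
  refine h3.trans ?_
  -- This uses `c N ≥ 1` and is the source of the factor `3`.
  have h4 : 2 * ((c * N : ℕ) : ℝ) + 1 ≤ 3 * (c * N) := by
    push_cast
    nlinarith
  calc (N : ℝ) * ((2 * ((c * N : ℕ) : ℝ) + 1) * centeredMean s (c * N))
      ≤ N * (3 * (c * N) * centeredMean s (c * N)) := by gcongr
    _ = _ := by ring

theorem integral_conj_iter_mul_iter {X 𝕜 : Type*} [MeasurableSpace X] [RCLike 𝕜] {μ : Measure X}
    {T : X ≃ᵐ X} (hT : MeasurePreserving T μ μ) {f : X → 𝕜} (hf : MemLp f ∞ μ) (m n : ℤ) :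
    ∫ x, conj (f (iter T m x)) * f (iter T n x) ∂μ = ∫ x, mulDeriv T f (n - m) x ∂μ := by
  have hm := measurePreserving_iter hT m
  conv_rhs => rw [← hm.map_eq]
  rw [integral_map hm.measurable.aemeasurable
    (by rw [hm.map_eq]; exact (memLp_mulDeriv hT hf (n - m)).1)]
  simp only [mulDeriv, ← iter_add, sub_add_cancel]

theorem lift_eq {X 𝕜 : Type*} [Mul 𝕜] (i : Fin 2) (f : X → 𝕜) (p : X × X × X) :
    lift i f p = f (pairProj i p).1 * f (pairProj i p).2 := rfl

theorem pairProj_iter_joiningMap {X : Type*} [MeasurableSpace X] (T : X ≃ᵐ X) (i : Fin 2) (n : ℤ)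
    (p : X × X × X) :
    pairProj i (iter (joiningMap T) n p) =
      (iter T n (pairProj i p).1, iter T n (pairProj i p).2) := by
  rw [iter_joiningMap]
  fin_cases i <;> rfl

/-- This identity drives the induction on `l`: differentiation acts on both factors separately. -/
theorem mulDeriv_lift {X 𝕜 : Type*} [MeasurableSpace X] [RCLike 𝕜] (T : X ≃ᵐ X) (i : Fin 2)
    (f : X → 𝕜) (h : ℤ) :
    mulDeriv (joiningMap T) (lift i f) h = lift i (mulDeriv T f h) := by
  funext p
  simp only [mulDeriv, lift_eq, pairProj_iter_joiningMap, map_mul]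
  ring

theorem norm_sq_correlation_le {X 𝕜 : Type*} [MeasurableSpace X] [RCLike 𝕜] {μ : Measure X}
    [IsProbabilityMeasure μ] {T : X ≃ᵐ X} (hT : MeasurePreserving T μ μ) {f : X → 𝕜}
    (hf : MemLp f ∞ μ) (m n : ℤ) :
    ‖∫ x, conj (f (iter T m x)) * f (iter T n x) ∂μ‖ ^ 2 ≤
      uniformitySeminorm μ T 1 1 (mulDeriv T f (n - m)) ^ 2 := by
  rw [integral_conj_iter_mul_iter hT hf]
  refine pow_le_pow_left₀ (norm_nonneg _) ?_ 2
  exact norm_integral_le_eLpNorm_condExp (MeasurableSpace.invariants_le _)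
    ((memLp_mulDeriv hT hf _).mono_exponent le_top)

theorem exists_ae_norm_le {X 𝕜 : Type*} [MeasurableSpace X] [RCLike 𝕜] {μ : Measure X}
    {f : X → 𝕜} (hf : MemLp f ∞ μ) :
    ∃ K : ℝ, 0 ≤ K ∧ ∀ᵐ x ∂μ, ‖f x‖ ≤ K := by
  refine ⟨(eLpNorm f ∞ μ).toReal, ENNReal.toReal_nonneg, ?_⟩
  filter_upwards [ae_le_eLpNormEssSup (f := f) (μ := μ)] with x hx
  rw [← eLpNorm_exponent_top] at hx
  simpa using ENNReal.toReal_mono hf.2.ne hx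

/-! ### The comparison of seminorms -/

section Main

variable {X Z 𝕜 : Type*} [MeasurableSpace X] [AddCommGroup Z] [TopologicalSpace Z]
  [IsTopologicalAddGroup Z] [CompactSpace Z] [MeasurableSpace Z] [BorelSpace Z]
  [T2Space Z] [SecondCountableTopology Z] [StandardBorelSpace X] [Nonempty X] [RCLike 𝕜]
  {μ : Measure X} [IsProbabilityMeasure μ] {T : X ≃ᵐ X} {π : X → Z} {α : Z}
  {a : Fin 2 → ℤ} {i : Fin 2} {f : X → 𝕜}

theorem IsKroneckerFactor.memLp_comp_pairProj (hK : IsKroneckerFactor μ T π α) (hi : a i ≠ 0)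
    {Φ : X × X → 𝕜} (hΦ : MemLp Φ ∞ (μ.prod μ)) :
    MemLp (Φ ∘ pairProj i) ∞ (joiningMeasure μ π α a) := by
  have h := map_pairProj_joiningMeasure_le μ hK.measurePreserving hK.dense_zmultiples a i hi
  exact (hΦ.of_measure_le_smul (ENNReal.natCast_ne_top _) h).comp_of_map
    (measurable_pairProj i).aemeasurable

theorem IsKroneckerFactor.memLp_lift (hK : IsKroneckerFactor μ T π α) (hi : a i ≠ 0)
    (hf : MemLp f ∞ μ) : MemLp (lift i f) ∞ (joiningMeasure μ π α a) := by
  refine hK.memLp_comp_pairProj hi (Φ := fun p => f p.1 * f p.2) ?_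
  exact (hf.comp_measurePreserving measurePreserving_snd).mul
    (hf.comp_measurePreserving measurePreserving_fst)

/-- Squared means of products `u_n(x) u_n(ξ_i)` in `L²(μ̃)` are controlled by the correlations
of the `u_n` in `L²(μ)`. -/
theorem IsKroneckerFactor.eLpNorm_mean_sq_le (hK : IsKroneckerFactor μ T π α) (hi : a i ≠ 0)
    {u : ℕ → X → 𝕜} (hu : ∀ n, MemLp (u n) ∞ μ) (N : ℕ) :
    (eLpNorm (fun p => (N : 𝕜)⁻¹ * ∑ n ∈ Finset.range N,
        u n (pairProj i p).1 * u n (pairProj i p).2) 2 (joiningMeasure μ π α a)).toReal ^ 2 ≤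
      (a i).natAbs * (((N : ℝ) ^ 2)⁻¹ * ∑ m ∈ Finset.range N, ∑ n ∈ Finset.range N,
        ‖∫ x, conj (u m x) * u n x ∂μ‖ ^ 2) := by
  set Φ : X × X → 𝕜 := fun p => (N : 𝕜)⁻¹ * ∑ n ∈ Finset.range N, u n p.1 * u n p.2
  have hΦ : MemLp Φ ∞ (μ.prod μ) := memLp_tensorMean hu N
  have hle := map_pairProj_joiningMeasure_le μ hK.measurePreserving hK.dense_zmultiples a i hi
  have h2 : MemLp Φ 2 (μ.prod μ) := hΦ.mono_exponent le_top
  have hsq : Integrable (fun p => ‖Φ p‖ ^ 2) (((a i).natAbs : ℝ≥0∞) • μ.prod μ) :=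
    (h2.integrable_norm_pow (by norm_num)).smul_measure (ENNReal.natCast_ne_top _)
  have hmem : MemLp (Φ ∘ pairProj i) 2 (joiningMeasure μ π α a) :=
    (hK.memLp_comp_pairProj hi hΦ).mono_exponent le_top
  calc (eLpNorm (Φ ∘ pairProj i) 2 (joiningMeasure μ π α a)).toReal ^ 2
      = ∫ p, ‖Φ p‖ ^ 2 ∂((joiningMeasure μ π α a).map (pairProj i)) := by
        rw [eLpNorm_two_toReal_sq hmem, integral_map (measurable_pairProj i).aemeasurable
          (hsq.mono_measure hle).1]
        rfl
    _ ≤ ∫ p, ‖Φ p‖ ^ 2 ∂(((a i).natAbs : ℝ≥0∞) • μ.prod μ) :=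
        integral_mono_measure hle (Eventually.of_forall fun p => by positivity) hsq
    _ = (a i).natAbs * ∫ p, ‖Φ p‖ ^ 2 ∂(μ.prod μ) := by
        rw [integral_smul_measure]; simp
    _ ≤ _ := by
        gcongr
        exact integral_norm_sq_tensorMean_le hu N

/-- The `U¹` seminorm of `F_i` in terms of a finite mean of correlations of `f`. -/
theorem IsKroneckerFactor.uniformitySeminorm_one_lift_le_correlations
    (hK : IsKroneckerFactor μ T π α) (hT : MeasurePreserving T μ μ) (hi : a i ≠ 0) (c : ℕ)
    (hf : MemLp f ∞ μ) {N : ℕ} (hN : 0 < N) :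
    uniformitySeminorm (joiningMeasure μ π α a) (joiningMap T) c 1 (lift i f) ^ 2 ≤
      (a i).natAbs * (((N : ℝ) ^ 2)⁻¹ * ∑ m ∈ Finset.range N, ∑ n ∈ Finset.range N,
        ‖∫ x, conj (f (iter T (c * m) x)) * f (iter T (c * n) x) ∂μ‖ ^ 2) := by
  have hS := measurePreserving_joiningMap μ hK.measurePreserving hT hK.equivariant a
  have hF : Integrable (lift i f) (joiningMeasure μ π α a) :=
    (hK.memLp_lift hi hf).integrable (by simp)
  let u : ℕ → X → 𝕜 := fun n => f ∘ iter T (c * n)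
  have hu : ∀ n, MemLp (u n) ∞ μ := fun n =>
    hf.comp_measurePreserving (measurePreserving_iter hT _)
  have h1 := eLpNorm_condExp_invariants_le (measurePreserving_iter hS c) hF hN
  have hmean : (fun p => (N : 𝕜)⁻¹ * ∑ n ∈ Finset.range N,
      lift i f ((iter (joiningMap T) c)^[n] p)) = fun p => (N : 𝕜)⁻¹ * ∑ n ∈ Finset.range N,
        u n (pairProj i p).1 * u n (pairProj i p).2 := by
    funext p
    simp only [iter_iterate, lift_eq, pairProj_iter_joiningMap]
    rfl
  rw [hmean] at h1
  have hmem : MemLp (fun p => (N : 𝕜)⁻¹ * ∑ n ∈ Finset.range N,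
      u n (pairProj i p).1 * u n (pairProj i p).2) 2 (joiningMeasure μ π α a) :=
    (hK.memLp_comp_pairProj hi (memLp_tensorMean hu N)).mono_exponent le_top
  have h2 := ENNReal.toReal_mono hmem.2.ne h1
  exact (pow_le_pow_left₀ ENNReal.toReal_nonneg h2 2).trans (hK.eLpNorm_mean_sq_le hi hu N)

/-- The case `l = 1`. -/
theorem IsKroneckerFactor.uniformitySeminorm_one_lift_le (hK : IsKroneckerFactor μ T π α)
    (hT : MeasurePreserving T μ μ) (hi : a i ≠ 0) {c : ℕ} (hc : 0 < c) (hf : MemLp f ∞ μ) :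
    uniformitySeminorm (joiningMeasure μ π α a) (joiningMap T) c 1 (lift i f) ^ 2 ≤
      3 * c * (a i).natAbs * uniformitySeminorm μ T 1 2 f ^ 4 := by
  obtain ⟨K, hK0, hfK⟩ := exists_ae_norm_le hf
  set s : ℤ → ℝ := fun h => uniformitySeminorm μ T 1 1 (mulDeriv T f h) ^ 2 with hsdef
  have hs : ∀ h, s h ∈ Set.Icc 0 ((K ^ 2) ^ 2) := fun h =>
    uniformitySeminorm_mulDeriv_pow_mem_Icc hT 1 1 hfK h 2
  have hU2 : uniformitySeminorm μ T 1 2 f ^ 4 = limsup (centeredMean s) atTop :=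
    uniformitySeminorm_add_two_pow hT 1 0 hfK
  have hbound : ∀ N : ℕ, 0 < N →
      uniformitySeminorm (joiningMeasure μ π α a) (joiningMap T) c 1 (lift i f) ^ 2 ≤
        3 * c * (a i).natAbs * centeredMean s (c * N) := by
    intro N hN
    have h1 : ∑ m ∈ Finset.range N, ∑ n ∈ Finset.range N,
        ‖∫ x, conj (f (iter T (c * m) x)) * f (iter T (c * n) x) ∂μ‖ ^ 2 ≤
        ∑ m ∈ Finset.range N, ∑ n ∈ Finset.range N, s (c * ((n : ℤ) - m)) := by
      refine Finset.sum_le_sum fun m _ => Finset.sum_le_sum fun n _ => ?_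
      rw [mul_sub]
      exact norm_sq_correlation_le hT hf _ _
    have h2 := sum_sum_sub_le_centeredMean (fun h => (hs h).1) hc hN
    have h3 := (mul_le_mul_of_nonneg_left h1 (by positivity : 0 ≤ ((N : ℝ) ^ 2)⁻¹)).trans h2
    refine (hK.uniformitySeminorm_one_lift_le_correlations hT hi c hf hN).trans
      ((mul_le_mul_of_nonneg_left h3 (Nat.cast_nonneg _)).trans_eq ?_)
    ring
  have hpos : (0 : ℝ) < 3 * c * (a i).natAbs := by
    have : 0 < (a i).natAbs := Int.natAbs_pos.2 hi
    positivity
  rw [hU2, ← div_le_iff₀' hpos]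
  -- The bound is available only at radii `c N`; these are cofinal, which is enough for an upper
  -- limit.
  refine le_limsup_of_frequently_le ?_ (isBoundedUnder_centeredMean fun h => (hs h).2)
  refine frequently_atTop.2 fun N => ⟨c * (N + 1), ?_, ?_⟩
  · exact N.le_succ.trans (Nat.le_mul_of_pos_left _ hc)
  · rw [div_le_iff₀' hpos]
    exact hbound (N + 1) N.succ_pos

theorem IsKroneckerFactor.uniformitySeminorm_lift_pow_le (hK : IsKroneckerFactor μ T π α)
    (hT : MeasurePreserving T μ μ) (hi : a i ≠ 0) {c : ℕ} (hc : 0 < c) (l : ℕ)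
    (hf : MemLp f ∞ μ) :
    uniformitySeminorm (joiningMeasure μ π α a) (joiningMap T) c (l + 1) (lift i f)
        ^ 2 ^ (l + 1) ≤
      3 * c * (a i).natAbs * uniformitySeminorm μ T 1 (l + 2) f ^ 2 ^ (l + 2) := by
  induction l generalizing f with
  | zero => exact hK.uniformitySeminorm_one_lift_le hT hi hc hf
  | succ l ih =>
    obtain ⟨K, hK0, hfK⟩ := exists_ae_norm_le hf
    obtain ⟨K', hK0', hfK'⟩ := exists_ae_norm_le (hK.memLp_lift (a := a) hi hf)
    have hS := measurePreserving_joiningMap μ hK.measurePreserving hT hK.equivariant a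
    rw [uniformitySeminorm_add_two_pow hS c l hfK',
      uniformitySeminorm_add_two_pow hT 1 (l + 1) hfK]
    have h1 := fun h =>
      uniformitySeminorm_mulDeriv_pow_mem_Icc hT 1 (l + 2) hfK h (2 ^ (l + 2))
    refine limsup_centeredMean_le_const_mul
      (fun h => (uniformitySeminorm_mulDeriv_pow_mem_Icc hS c (l + 1) hfK' h _).1)
      (fun h => (h1 h).1) (fun h => (h1 h).2) (by positivity) fun h => ?_
    rw [mulDeriv_lift]
    exact ih (memLp_mulDeriv hT hf h)

end Main

end ErgodicLift

theorem mainTheorem6 (b : ℤ) (hb : b ≠ 0) (l : ℕ) (hl : 1 ≤ l) (c : ℕ) (hc : 0 < c) :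
    ∃ C : ℝ, ∀ (𝕜 X Z : Type*) [RCLike 𝕜]
      [MeasurableSpace X] [StandardBorelSpace X] [Nonempty X]
      [AddCommGroup Z] [TopologicalSpace Z] [IsTopologicalAddGroup Z] [CompactSpace Z] [T2Space Z]
      [SecondCountableTopology Z] [MeasurableSpace Z] [BorelSpace Z]
      (μ : Measure X) [IsProbabilityMeasure μ] (T : X ≃ᵐ X) (_ : Ergodic T μ)
      (π : X → Z) (α : Z) (_ : ErgodicLift.IsKroneckerFactor μ T π α)
      (a : Fin 2 → ℤ) (_ : ∀ j, a j ≠ 0) (_ : a 0 ≠ a 1)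
      (i : Fin 2) (_ : a i = b) (f : X → 𝕜) (_ : MemLp f ∞ μ),
      ErgodicLift.uniformitySeminorm (ErgodicLift.joiningMeasure μ π α a)
          (ErgodicLift.joiningMap T) (c : ℤ) l (ErgodicLift.lift i f)
        ≤ C * ErgodicLift.uniformitySeminorm μ T 1 (l + 1) f ^ 2 := by
  obtain ⟨l, rfl⟩ : ∃ k, l = k + 1 := ⟨l - 1, by omega⟩
  -- The inequality between powers has factor `3 c |b|`; the constant is its `2^(l+1)`-th root.
  refine ⟨(3 * c * b.natAbs : ℝ) ^ ((1 : ℝ) / 2 ^ (l + 1)), ?_⟩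
  intro 𝕜 X Z _ _ _ _ _ _ _ _ _ _ _ _ μ _ T hT π α hK a ha _ i hi f hf
  have h := hK.uniformitySeminorm_lift_pow_le hT.toMeasurePreserving (ha i) hc l hf
  rw [hi] at h
  have hD : (0 : ℝ) ≤ 3 * c * b.natAbs := by positivity
  refine le_of_pow_le_pow_left₀ (n := 2 ^ (l + 1)) (by positivity) (by positivity) ?_
  -- The exponents match because `2 · 2^(l+1) = 2^(l+2)`.
  rw [mul_pow, ErgodicLift.rpow_one_div_two_pow_pow hD, ← pow_mul, ← pow_succ']
  exact h
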